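/- A convex body in $\mathbb{R}^2$ is a compact convex set with non-empty interior. Let $K\subset\mathbb{R}^2$ be a convex body that is symmetric about the origin $o$ (that is, $-K=K$), let $$K^*=\{x\in\mathbb{R}^2 : \langle x,y\rangle\le 1 \text{ for all } y\in K\}$$ be its polar, and let $|\cdot|$ denote area. Then $$|K|\cdot|K^*|\ \ge\ 8,$$ with equality if and only if $K$ is a parallelogram. -/

import Mathlib

open MeasureTheory

/-- The polar `K* = {x | ⟪x, y⟫ ≤ 1 for all y ∈ K}` of a set `K ⊆ ℝᵈ` with respect to the unit
sphere centred at the origin. (`LinearMap.polar` in Mathlib is the absolute polar, with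
`|⟪x, y⟫| ≤ 1`, so it is not used here.) -/
def polarBody {d : ℕ} (K : Set (EuclideanSpace ℝ (Fin d))) : Set (EuclideanSpace ℝ (Fin d)) :=
  {x | ∀ y ∈ K, inner ℝ x y ≤ 1}

/-- A (non-degenerate, solid) parallelogram in the plane: a set of the form
`{p + s u + t v | 0 ≤ s, t ≤ 1}` with `u, v` linearly independent. -/
def IsParallelogram (P : Set (EuclideanSpace ℝ (Fin 2))) : Prop :=
  ∃ p u v : EuclideanSpace ℝ (Fin 2), LinearIndependent ℝ ![u, v] ∧
    P = (fun x => p + x) '' parallelepiped ![u, v]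

/-! The volume product is invariant under linear automorphisms. Choosing `e`, `f` in `K` with `cross
e f` maximal and using them as basis puts `K` inside the square `[-1, 1]²`, so that both `K` and its
polar `L` contain the standard basis (`exists_auerbachPair`).

Let `A`, `B` be the areas of `K`, `L` in the first quadrant. For `x ∈ K` in that quadrant, the
triangles `0, (1,0), x` and `0, x, (0,1)` lie in `K`, so `x.1 + x.2 ≤ 2A`; hence `(1/(2A), 1/(2A)) ∈
L`. Likewise `(1/(2B), 1/(2B)) ∈ K`, and pairing the two points gives `AB ≥ 1/2` (`half_le_mul`).
The same holds in the second quadrant; central symmetry and AM-GM then give 8.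

Equality forces `AB = 1/2` in both quadrants, with equal areas of `K` there. Comparing areas of
three triangles, in `K` and then in `L`, leaves only `A = 1/2` or `A = 1`
(`volume_eq_of_mul_eq_half`): `K` is the diamond or the square. -/

/-! ### Linear maps of the plane and area -/

/-- The determinant of two vectors of the plane. -/
def cross (u v : ℝ × ℝ) : ℝ := u.1 * v.2 - u.2 * v.1

/-- The linear map `(s, t) ↦ s u + t v`. -/
noncomputable def combo (u v : ℝ × ℝ) : (ℝ × ℝ) →ₗ[ℝ] (ℝ × ℝ) :=
  Matrix.toLin (Module.Basis.finTwoProd ℝ) (Module.Basis.finTwoProd ℝ) !![u.1, v.1; u.2, v.2]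

theorem combo_apply (u v z : ℝ × ℝ) :
    combo u v z = (u.1 * z.1 + v.1 * z.2, u.2 * z.1 + v.2 * z.2) := by
  rw [combo, Matrix.toLin_finTwoProd_apply]

theorem det_combo (u v : ℝ × ℝ) : LinearMap.det (combo u v) = cross u v := by
  rw [combo, LinearMap.det_toLin, Matrix.det_fin_two_of, cross]
  ring

theorem volume_real_image_combo (u v : ℝ × ℝ) (S : Set (ℝ × ℝ)) :
    volume.real (combo u v '' S) = |cross u v| * volume.real S := by
  rw [measureReal_def, Measure.addHaar_image_linearMap, det_combo, ENNReal.toReal_mul,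
    ENNReal.toReal_ofReal (abs_nonneg _), measureReal_def]

theorem volume_real_preimage_combo (u v : ℝ × ℝ) (h : cross u v ≠ 0) (S : Set (ℝ × ℝ)) :
    volume.real (combo u v ⁻¹' S) = |cross u v|⁻¹ * volume.real S := by
  have hd : LinearMap.det (combo u v) ≠ 0 := by rwa [det_combo]
  rw [measureReal_def, Measure.addHaar_preimage_linearMap _ hd, det_combo, ENNReal.toReal_mul,
    ENNReal.toReal_ofReal (abs_nonneg _), measureReal_def, abs_inv]

/-! ### Triangles with apex at the origin -/

/-- The open triangle with vertices `0`, `u`, `v`, empty unless `0 < cross u v`. -/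
def openTriangle (u v : ℝ × ℝ) : Set (ℝ × ℝ) :=
  {z | 0 < cross u z ∧ 0 < cross z v ∧ cross u z + cross z v < cross u v}

theorem isOpen_openTriangle (u v : ℝ × ℝ) : IsOpen (openTriangle u v) := by
  simp only [openTriangle, cross, Set.ofPred_and]
  refine IsOpen.inter ?_ (IsOpen.inter ?_ ?_) <;> exact isOpen_lt (by fun_prop) (by fun_prop)

theorem volume_real_openTriangle_std : volume.real (openTriangle (1, 0) (0, 1)) = 1 / 2 := by
  have h : openTriangle (1, 0) (0, 1)
      = regionBetween (fun _ : ℝ => (0 : ℝ)) (fun x => 1 - x) (Set.Ioo 0 1) := by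
    ext ⟨x, y⟩
    simp only [openTriangle, cross, regionBetween, Set.mem_ofPred_eq, Set.mem_Ioo]
    constructor
    · rintro ⟨h1, h2, h3⟩
      refine ⟨⟨?_, ?_⟩, ?_, ?_⟩ <;> linarith
    · rintro ⟨⟨h1, h2⟩, h3, h4⟩
      refine ⟨?_, ?_, ?_⟩ <;> linarith
  have hi : ∀ f : ℝ → ℝ, Continuous f → IntegrableOn f (Set.Ioo 0 1) := fun f hf =>
    (hf.integrableOn_Icc (a := 0) (b := 1)).mono_set Set.Ioo_subset_Icc_self
  rw [h, measureReal_def, Measure.volume_eq_prod, volume_regionBetween_eq_integral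
    (hi _ (by fun_prop)) (hi _ (by fun_prop)) measurableSet_Ioo
    (fun x hx => by linarith [hx.2])]
  have hv : ∫ x in Set.Ioo (0 : ℝ) 1, ((fun x : ℝ => 1 - x) - fun _ : ℝ => (0 : ℝ)) x = 1 / 2 := by
    rw [← integral_Ioc_eq_integral_Ioo, ← intervalIntegral.integral_of_le zero_le_one]
    simp only [Pi.sub_apply, sub_zero]
    rw [intervalIntegral.integral_sub (by simp) (by simp)]
    simp
    norm_num
  rw [hv, ENNReal.toReal_ofReal (by norm_num)]

/-- For positive determinant the triangle is the linear image of the standard one. Otherwise the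
bound is trivial, so degenerate triangles need no separate treatment later. -/
theorem cross_div_two_le_volume_openTriangle (u v : ℝ × ℝ) :
    cross u v / 2 ≤ volume.real (openTriangle u v) := by
  rcases le_or_gt (cross u v) 0 with h | h
  · linarith [measureReal_nonneg (μ := volume) (s := openTriangle u v)]
  · have hs : combo u v '' openTriangle (1, 0) (0, 1) ⊆ openTriangle u v := by
      rintro _ ⟨z, ⟨h1, h2, h3⟩, rfl⟩
      rw [combo_apply]
      simp only [cross, openTriangle, Set.mem_ofPred_eq] at h h1 h2 h3 ⊢
      refine ⟨?_, ?_, ?_⟩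
      · linarith [mul_pos (show 0 < z.2 by linarith) h]
      · linarith [mul_pos (show 0 < z.1 by linarith) h]
      · linarith [mul_pos (show 0 < 1 - z.1 - z.2 by linarith) h]
    have hb : openTriangle u v ⊆ combo u v '' openTriangle (1, 0) (0, 1) := by
      rintro z ⟨h1, h2, h3⟩
      have h0 := h.ne'
      refine ⟨(cross z v / cross u v, cross u z / cross u v), ⟨?_, ?_, ?_⟩, ?_⟩
      · simp only [cross, one_mul, zero_mul, sub_zero]; exact div_pos h1 h
      · simp only [cross, mul_one, mul_zero, sub_zero]; exact div_pos h2 h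
      · have := (div_lt_one h).2 h3
        rw [add_div] at this
        simp only [cross, mul_one, one_mul, mul_zero, zero_mul, sub_zero] at this ⊢
        exact this
      · rw [combo_apply]
        ext
        · field_simp; simp only [cross]; ring
        · field_simp; simp only [cross]; ring
    rw [hb.antisymm hs, volume_real_image_combo, volume_real_openTriangle_std, abs_of_pos h]
    linarith

theorem openTriangle_subset {K : Set (ℝ × ℝ)} (hK : Convex ℝ K) (h0 : (0 : ℝ × ℝ) ∈ K)
    {u v : ℝ × ℝ} (hu : u ∈ K) (hv : v ∈ K) : openTriangle u v ⊆ K := by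
  rintro z ⟨h1, h2, h3⟩
  have h : 0 < cross u v := by linarith
  -- By Cramer's rule these are the barycentric coordinates of `z` with respect to `u`, `v`, `0`.
  have hc := hK.sum_mem (t := Finset.univ)
    (w := ![cross z v / cross u v, cross u z / cross u v,
      (cross u v - cross u z - cross z v) / cross u v]) (z := ![u, v, 0])
    (by
      intro i _
      fin_cases i
      · exact (div_pos h2 h).le
      · exact (div_pos h1 h).le
      · exact div_nonneg (by linarith) h.le)
    (by
      simp [Fin.sum_univ_three]
      field_simp
      ring)
    (by intro i _; fin_cases i <;> assumption)
  convert hc using 1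
  have h0 := h.ne'
  simp [Fin.sum_univ_three]
  ext
  · simp; field_simp; simp only [cross]; ring
  · simp; field_simp; simp only [cross]; ring

/-- The open first quadrant. -/
def quadrant : Set (ℝ × ℝ) := {z | 0 < z.1 ∧ 0 < z.2}

theorem openTriangle_subset_quadrant {u v : ℝ × ℝ} (hu1 : 0 ≤ u.1) (hu2 : 0 ≤ u.2)
    (hv1 : 0 ≤ v.1) (hv2 : 0 ≤ v.2) : openTriangle u v ⊆ quadrant := by
  rintro z ⟨h1, h2, h3⟩
  have h : 0 < cross u v := by linarith
  have e1 : cross u v * z.1 = cross z v * u.1 + cross u z * v.1 := by simp only [cross]; ring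
  have e2 : cross u v * z.2 = cross z v * u.2 + cross u z * v.2 := by simp only [cross]; ring
  constructor
  · refine pos_of_mul_pos_right (a := cross u v) ?_ h.le
    rw [e1]
    rcases hu1.lt_or_eq with h' | h'
    · positivity
    rcases hv1.lt_or_eq with h'' | h''
    · positivity
    · simp [cross, ← h', ← h''] at h
  · refine pos_of_mul_pos_right (a := cross u v) ?_ h.le
    rw [e2]
    rcases hu2.lt_or_eq with h' | h'
    · positivity
    rcases hv2.lt_or_eq with h'' | h''
    · positivity
    · simp [cross, ← h', ← h''] at h

/-- Three triangles with apex `0` inside the part of a convex set in the first quadrant. -/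
theorem add_cross_add_le_two_mul_volume {K : Set (ℝ × ℝ)} (hK : Convex ℝ K)
    (h0 : (0 : ℝ × ℝ) ∈ K) (he : ((1, 0) : ℝ × ℝ) ∈ K) (hf : ((0, 1) : ℝ × ℝ) ∈ K)
    (hfin : volume K ≠ ⊤) {x y : ℝ × ℝ} (hx : x ∈ K) (hy : y ∈ K)
    (hx1 : 0 ≤ x.1) (hx2 : 0 ≤ x.2) (hy1 : 0 ≤ y.1) (hy2 : 0 ≤ y.2) (hxy : 0 ≤ cross x y) :
    x.2 + cross x y + y.1 ≤ 2 * volume.real (K ∩ quadrant) := by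
  have hsub : openTriangle (1, 0) x ∪ openTriangle x y ∪ openTriangle y (0, 1)
      ⊆ K ∩ quadrant := by
    refine Set.union_subset (Set.union_subset ?_ ?_) ?_ <;>
    refine Set.subset_inter (openTriangle_subset hK h0 ‹_› ‹_›)
      (openTriangle_subset_quadrant ?_ ?_ ?_ ?_) <;> first | assumption | simp
  have hQ := fun u v => (openTriangle_subset (u := u) (v := v) hK h0)
  have hfin' : volume (K ∩ quadrant) ≠ ⊤ := measure_ne_top_of_subset Set.inter_subset_left hfin
  have hle := measureReal_mono hsub hfin'
  have hfinT : ∀ S, S ⊆ K → volume S ≠ ⊤ := fun S hS => measure_ne_top_of_subset hS hfin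
  have d1 : Disjoint (openTriangle (1, 0) x) (openTriangle x y) := by
    rw [Set.disjoint_left]
    rintro z ⟨_, h2, _⟩ ⟨h3, _, _⟩
    simp only [cross] at h2 h3
    linarith
  have d2 : Disjoint (openTriangle (1, 0) x ∪ openTriangle x y) (openTriangle y (0, 1)) := by
    rw [Set.disjoint_left]
    rintro z (⟨h1, h2, _⟩ | ⟨h1, h2, _⟩) ⟨h3, h4, _⟩
    · simp only [cross] at h1 h2 h3 h4 hxy
      have hz1 : 0 < z.1 := by linarith
      have hz2 : 0 < z.2 := by linarith
      have hx2' : 0 < x.2 := by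
        rcases hx2.lt_or_eq with h | h
        · exact h
        · rw [← h] at h2; nlinarith
      -- The contradiction comes from `x.2 * cross y z + y.2 * cross z x + z.2 * cross x y = 0`.
      nlinarith [mul_nonneg hy2 h2.le, mul_pos hx2' h3, mul_nonneg hz2.le hxy]
    · simp only [cross] at h2 h3
      linarith
  rw [measureReal_union d2 (isOpen_openTriangle _ _).measurableSet
      (hfinT _ (Set.union_subset (hQ _ _ he hx) (hQ _ _ hx hy))) (hfinT _ (hQ _ _ hy hf)),
    measureReal_union d1 (isOpen_openTriangle _ _).measurableSet
      (hfinT _ (hQ _ _ he hx)) (hfinT _ (hQ _ _ hx hy))] at hle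
  have t1 := cross_div_two_le_volume_openTriangle (1, 0) x
  have t2 := cross_div_two_le_volume_openTriangle x y
  have t3 := cross_div_two_le_volume_openTriangle y (0, 1)
  have c1 : cross (1, 0) x = x.2 := by simp [cross]
  have c3 : cross y (0, 1) = y.1 := by simp [cross]
  rw [c1] at t1
  rw [c3] at t3
  linarith

/-! ### Auerbach position and the inequality in one quadrant -/

/-- The scalar product of the coordinate plane. -/
def dot (x y : ℝ × ℝ) : ℝ := x.1 * y.1 + x.2 * y.2

theorem dot_comm (x y : ℝ × ℝ) : dot x y = dot y x := by simp only [dot]; ring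

/-- A pair of mutually polar symmetric sets, both containing the standard basis. -/
structure AuerbachPair (K L : Set (ℝ × ℝ)) : Prop where
  mem_left : ∀ x, x ∈ K ↔ ∀ y ∈ L, dot x y ≤ 1
  mem_right : ∀ y, y ∈ L ↔ ∀ x ∈ K, dot x y ≤ 1
  neg_left : ∀ x ∈ K, -x ∈ K
  fst_left : ((1, 0) : ℝ × ℝ) ∈ K
  snd_left : ((0, 1) : ℝ × ℝ) ∈ K
  fst_right : ((1, 0) : ℝ × ℝ) ∈ L
  snd_right : ((0, 1) : ℝ × ℝ) ∈ L

namespace AuerbachPair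

variable {K L : Set (ℝ × ℝ)}

theorem symm (h : AuerbachPair K L) : AuerbachPair L K where
  mem_left y := by simp only [h.mem_right, dot_comm]
  mem_right x := by simp only [h.mem_left, dot_comm]
  neg_left y hy := by
    rw [h.mem_right] at hy ⊢
    intro x hx
    have := hy _ (h.neg_left x hx)
    simp only [dot, Prod.fst_neg, Prod.snd_neg] at this ⊢
    linarith
  fst_left := h.fst_right
  snd_left := h.snd_right
  fst_right := h.fst_left
  snd_right := h.snd_left

theorem zero_mem (h : AuerbachPair K L) : (0 : ℝ × ℝ) ∈ K := by
  rw [h.mem_left]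
  intro y _
  simp [dot]

theorem convex (h : AuerbachPair K L) : Convex ℝ K := by
  intro x hx y hy a b ha hb hab
  rw [h.mem_left] at hx hy ⊢
  intro z hz
  have h1 := mul_le_mul_of_nonneg_left (hx z hz) ha
  have h2 := mul_le_mul_of_nonneg_left (hy z hz) hb
  simp only [dot, Prod.fst_add, Prod.snd_add, Prod.smul_fst, Prod.smul_snd, smul_eq_mul] at *
  linarith

theorem isClosed (h : AuerbachPair K L) : IsClosed K := by
  have hK : K = ⋂ y ∈ L, {x | dot x y ≤ 1} := by
    ext x
    simp [h.mem_left]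
  rw [hK]
  refine isClosed_biInter fun y _ => isClosed_le ?_ continuous_const
  unfold dot
  fun_prop

theorem abs_fst_le (h : AuerbachPair K L) {x : ℝ × ℝ} (hx : x ∈ K) : |x.1| ≤ 1 := by
  have h1 := (h.mem_left _).1 hx _ h.fst_right
  have h2 := (h.mem_left _).1 (h.neg_left _ hx) _ h.fst_right
  simp only [dot, Prod.fst_neg, Prod.snd_neg] at h1 h2
  exact abs_le.2 ⟨by linarith, by linarith⟩

theorem abs_snd_le (h : AuerbachPair K L) {x : ℝ × ℝ} (hx : x ∈ K) : |x.2| ≤ 1 := by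
  have h1 := (h.mem_left _).1 hx _ h.snd_right
  have h2 := (h.mem_left _).1 (h.neg_left _ hx) _ h.snd_right
  simp only [dot, Prod.fst_neg, Prod.snd_neg] at h1 h2
  exact abs_le.2 ⟨by linarith, by linarith⟩

theorem volume_ne_top (h : AuerbachPair K L) : volume K ≠ ⊤ := by
  have hs : K ⊆ Set.Icc (-1) 1 := fun x hx =>
    ⟨⟨(abs_le.1 (h.abs_fst_le hx)).1, (abs_le.1 (h.abs_snd_le hx)).1⟩,
      ⟨(abs_le.1 (h.abs_fst_le hx)).2, (abs_le.1 (h.abs_snd_le hx)).2⟩⟩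
  exact measure_ne_top_of_subset hs isCompact_Icc.measure_lt_top.ne

theorem three_triangles (h : AuerbachPair K L) {x y : ℝ × ℝ} (hx : x ∈ K) (hy : y ∈ K)
    (hx1 : 0 ≤ x.1) (hx2 : 0 ≤ x.2) (hy1 : 0 ≤ y.1) (hy2 : 0 ≤ y.2) (hxy : 0 ≤ cross x y) :
    x.2 + cross x y + y.1 ≤ 2 * volume.real (K ∩ quadrant) :=
  add_cross_add_le_two_mul_volume h.convex h.zero_mem h.fst_left h.snd_left h.volume_ne_top
    hx hy hx1 hx2 hy1 hy2 hxy

/-- With both intermediate points equal to `x`, the middle triangle degenerates. -/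
theorem fst_add_snd_le (h : AuerbachPair K L) {x : ℝ × ℝ} (hx : x ∈ K)
    (hx1 : 0 ≤ x.1) (hx2 : 0 ≤ x.2) : x.1 + x.2 ≤ 2 * volume.real (K ∩ quadrant) := by
  have hc : cross x x = 0 := by simp only [cross]; ring
  have := h.three_triangles hx hx hx1 hx2 hx1 hx2 hc.ge
  linarith

theorem half_le_volume (h : AuerbachPair K L) : 1 / 2 ≤ volume.real (K ∩ quadrant) := by
  have := h.fst_add_snd_le h.fst_left (by norm_num) le_rfl
  norm_num at this
  linarith

theorem diagonal_mem (h : AuerbachPair K L) :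
    ((1 / (2 * volume.real (K ∩ quadrant)), 1 / (2 * volume.real (K ∩ quadrant))) : ℝ × ℝ)
      ∈ L := by
  rw [h.mem_right]
  intro x hx
  have hq := h.half_le_volume
  have hx1 := abs_le.1 (h.abs_fst_le hx)
  have hx2 := abs_le.1 (h.abs_snd_le hx)
  -- Outside the closed first quadrant the box bounds give `x.1 + x.2 ≤ 1`, and `1` is at most twice
  -- the quadrant area.
  have hs : x.1 + x.2 ≤ 2 * volume.real (K ∩ quadrant) := by
    rcases le_or_gt 0 x.1 with h1 | h1
    · rcases le_or_gt 0 x.2 with h2 | h2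
      · exact h.fst_add_snd_le hx h1 h2
      · linarith
    · linarith
  have hp : 0 < 2 * volume.real (K ∩ quadrant) := by linarith
  simp only [dot]
  rw [← add_mul, mul_one_div, div_le_one hp]
  exact hs

theorem half_le_mul (h : AuerbachPair K L) :
    1 / 2 ≤ volume.real (K ∩ quadrant) * volume.real (L ∩ quadrant) := by
  have hd := (h.mem_left _).1 h.symm.diagonal_mem _ h.diagonal_mem
  have hq := h.half_le_volume
  have hq' := h.symm.half_le_volume
  set a := volume.real (K ∩ quadrant)
  set b := volume.real (L ∩ quadrant)
  have ha : 0 < a := by linarith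
  have hb : 0 < b := by linarith
  simp only [dot] at hd
  field_simp at hd
  linarith

/-! ### Equality in one quadrant -/

/-- If the quadrant bound is attained, the corner point `(1, 1 / A - 1)` of the polar of the
octagon spanned by `(A, A)` and the basis vectors belongs to the polar set. -/
theorem corner_mem (h : AuerbachPair K L) (hA1 : volume.real (K ∩ quadrant) ≤ 1)
    (hd : ((volume.real (K ∩ quadrant), volume.real (K ∩ quadrant)) : ℝ × ℝ) ∈ K) :
    ((1, 1 / volume.real (K ∩ quadrant) - 1) : ℝ × ℝ) ∈ L := by
  have hq := h.half_le_volume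
  have ht := fun x y hx hy => h.three_triangles (x := x) (y := y) hx hy
  set A := volume.real (K ∩ quadrant)
  have hA : 0 < A := by linarith
  have hc0 : 0 ≤ 1 / A - 1 := by rw [sub_nonneg, le_div_iff₀ hA]; linarith
  have hc1 : 1 / A - 1 ≤ 1 := by rw [sub_le_iff_le_add, div_le_iff₀ hA]; linarith
  have hAc : A * (1 / A - 1) = 1 - A := by field_simp
  set c := 1 / A - 1
  have below : ∀ x ∈ K, 0 ≤ x.2 → x.2 ≤ x.1 → x.1 + c * x.2 ≤ 1 := by
    intro x hx h2 h12
    -- The three triangles give `x.2 + A * (x.1 - x.2) + A ≤ 2 * A`, which is the claim multiplied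
    -- by `A`.
    have h3 := ht x (A, A) hx hd (by linarith) h2 hA.le hA.le
      (by simp only [cross]; linarith [mul_nonneg hA.le (sub_nonneg.2 h12)])
    simp only [cross] at h3
    refine le_of_mul_le_mul_left ?_ hA
    have : A * (x.1 + c * x.2) = A * x.1 + (A * c) * x.2 := by ring
    rw [this, hAc]
    linarith
  have above : ∀ x ∈ K, 0 ≤ x.1 → x.1 ≤ x.2 → x.2 + c * x.1 ≤ 1 := by
    intro x hx h1 h12
    have h3 := ht (A, A) x hd hx hA.le hA.le h1 (by linarith)
      (by simp only [cross]; linarith [mul_nonneg hA.le (sub_nonneg.2 h12)])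
    simp only [cross] at h3
    refine le_of_mul_le_mul_left ?_ hA
    have : A * (x.2 + c * x.1) = A * x.2 + (A * c) * x.1 := by ring
    rw [this, hAc]
    linarith
  rw [h.mem_right]
  intro x hx
  have hx1 := abs_le.1 (h.abs_fst_le hx)
  have hx2 := abs_le.1 (h.abs_snd_le hx)
  simp only [dot]
  rcases le_or_gt 0 x.1 with h1 | h1
  · rcases le_or_gt 0 x.2 with h2 | h2
    · rcases le_total x.2 x.1 with h12 | h12
      · linarith [below x hx h2 h12]
      -- Above the diagonal the mirrored inequality is the stronger one, because `c ≤ 1`.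
      · linarith [above x hx h1 h12, mul_nonneg (sub_nonneg.2 hc1) (sub_nonneg.2 h12)]
    · linarith [mul_nonneg hc0 (neg_pos.2 h2).le]
  · linarith [mul_nonneg hc0 (sub_nonneg.2 hx2.2)]

theorem volume_eq_of_mul_eq_half (h : AuerbachPair K L)
    (he : volume.real (K ∩ quadrant) * volume.real (L ∩ quadrant) = 1 / 2) :
    volume.real (K ∩ quadrant) = 1 / 2 ∨
      volume.real (K ∩ quadrant) = 1 ∧ ((1, 1) : ℝ × ℝ) ∈ K := by
  have hq := h.half_le_volume
  have hq' := h.symm.half_le_volume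
  have hdK := h.symm.diagonal_mem
  have hdL := h.diagonal_mem
  have hc := h.corner_mem
  have ht := fun x y hx hy => h.symm.three_triangles (x := x) (y := y) hx hy
  set A := volume.real (K ∩ quadrant)
  set B := volume.real (L ∩ quadrant)
  have hA : 0 < A := by linarith
  have hB : B = 1 / (2 * A) := by field_simp; linarith
  have hBA : 1 / (2 * B) = A := by rw [hB]; field_simp
  rw [hBA] at hdK
  have hA1 : A ≤ 1 := by nlinarith
  have hc0 : 0 ≤ 1 / A - 1 := by rw [sub_nonneg, le_div_iff₀ hA]; linarith
  have hc1 : 1 / A - 1 ≤ 1 := by rw [sub_le_iff_le_add, div_le_iff₀ hA]; linarith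
  -- The three-triangle bound, now in `L`, for the corner `(1, 1/A - 1)` and the diagonal point; `B
  -- = 1/(2A)` turns it into `(2A - 1)(1 - A) ≤ 0`.
  have h3 := ht _ _ (hc hA1 hdK) hdL zero_le_one hc0 (by positivity) (by positivity) (by
    simp only [cross]
    have : 0 ≤ 1 / (2 * A) := by positivity
    nlinarith [mul_nonneg this (sub_nonneg.2 hc1)])
  simp only [cross] at h3
  rw [hB] at h3
  have h4 : (2 * A - 1) * (1 - A) ≤ 0 := by
    field_simp at h3
    nlinarith
  rcases hq.lt_or_eq with hlt | heq
  · right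
    have : A = 1 := by nlinarith
    exact ⟨this, by rwa [this] at hdK⟩
  · exact Or.inl heq.symm

/-! ### Combining the quadrants -/

/-- Reflection of an Auerbach pair in the second coordinate axis. -/
theorem reflect (h : AuerbachPair K L) :
    AuerbachPair (combo (-1, 0) (0, 1) ⁻¹' K) (combo (-1, 0) (0, 1) ⁻¹' L) := by
  have hr : ∀ z : ℝ × ℝ, combo (-1, 0) (0, 1) z = (-z.1, z.2) := by
    intro z
    simp [combo_apply]
  have hdot : ∀ x y : ℝ × ℝ, dot (-x.1, x.2) y = dot x (-y.1, y.2) := by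
    intro x y
    simp [dot]
  constructor
  · intro x
    rw [Set.mem_preimage, hr, h.mem_left]
    constructor
    · intro hx y hy
      have := hx _ hy
      rw [hr, ← hdot] at this
      simpa [dot] using this
    · intro hx y hy
      rw [hdot]
      exact hx _ (by rw [Set.mem_preimage, hr]; simpa using hy)
  · intro x
    rw [Set.mem_preimage, hr, h.mem_right]
    constructor
    · intro hx y hy
      have := hx _ hy
      rw [hr] at this
      simpa [dot] using this
    · intro hx y hy
      rw [← hdot]
      exact hx _ (by rw [Set.mem_preimage, hr]; simpa using hy)
  · intro x hx
    rw [Set.mem_preimage, map_neg]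
    exact h.neg_left _ hx
  · rw [Set.mem_preimage, hr]
    simpa using h.neg_left _ h.fst_left
  · rw [Set.mem_preimage, hr]
    simpa using h.snd_left
  · rw [Set.mem_preimage, hr]
    simpa using h.symm.neg_left _ h.fst_right
  · rw [Set.mem_preimage, hr]
    simpa using h.snd_right

/-- Central symmetry exchanges the two open half-planes. Only this direction is needed, so the axis
need not be shown to be null. -/
theorem two_mul_volume_upper_le (h : AuerbachPair K L) :
    2 * volume.real (K ∩ {z | 0 < z.2}) ≤ volume.real K := by
  have hm : MeasurableSet {z : ℝ × ℝ | z.2 < 0} :=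
    (isOpen_lt (by fun_prop) (by fun_prop)).measurableSet
  have hfin : ∀ S, volume (K ∩ S) ≠ ⊤ := fun S =>
    measure_ne_top_of_subset Set.inter_subset_left h.volume_ne_top
  have hd : Disjoint (K ∩ {z | 0 < z.2}) (K ∩ {z | z.2 < 0}) := by
    rw [Set.disjoint_left]
    intro z hz hz'
    have h1 : 0 < z.2 := hz.2
    have h2 : z.2 < 0 := hz'.2
    exact lt_asymm h1 h2
  have he : volume.real (K ∩ {z | z.2 < 0}) = volume.real (K ∩ {z | 0 < z.2}) := by
    have : K ∩ {z | z.2 < 0} = Neg.neg ⁻¹' (K ∩ {z | 0 < z.2}) := by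
      ext z
      have : z ∈ K ↔ -z ∈ K := ⟨h.neg_left z, fun hz => neg_neg z ▸ h.neg_left _ hz⟩
      simp only [Set.mem_inter_iff, Set.mem_ofPred_eq, Set.mem_preimage, Prod.snd_neg,
        Left.neg_pos_iff, this]
    rw [this, Set.neg_preimage, measureReal_def, Measure.measure_neg, measureReal_def]
  have hle := measureReal_mono (μ := volume)
    (Set.union_subset (Set.inter_subset_left (s := K) (t := {z | 0 < z.2}))
      (Set.inter_subset_left (s := K) (t := {z | z.2 < 0}))) h.volume_ne_top
  rw [measureReal_union hd (h.isClosed.measurableSet.inter hm) (hfin _) (hfin _), he] at hle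
  linarith

theorem add_volume_le_upper (h : AuerbachPair K L) :
    volume.real (K ∩ quadrant) + volume.real (combo (-1, 0) (0, 1) ⁻¹' K ∩ quadrant)
      ≤ volume.real (K ∩ {z | 0 < z.2}) := by
  have hr : ∀ z : ℝ × ℝ, combo (-1, 0) (0, 1) z = (-z.1, z.2) := by
    intro z
    simp [combo_apply]
  have hm : MeasurableSet {z : ℝ × ℝ | z.1 < 0 ∧ 0 < z.2} := by
    rw [Set.ofPred_and]
    exact ((isOpen_lt (by fun_prop) (by fun_prop)).inter
      (isOpen_lt (by fun_prop) (by fun_prop))).measurableSet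
  have hfin : ∀ S, volume (K ∩ S) ≠ ⊤ := fun S =>
    measure_ne_top_of_subset Set.inter_subset_left h.volume_ne_top
  have hd : Disjoint (K ∩ quadrant) (K ∩ {z | z.1 < 0 ∧ 0 < z.2}) := by
    rw [Set.disjoint_left]
    intro z hz hz'
    have h1 : 0 < z.1 := hz.2.1
    have h2 : z.1 < 0 := hz'.2.1
    exact lt_asymm h1 h2
  have he : volume.real (combo (-1, 0) (0, 1) ⁻¹' K ∩ quadrant)
      = volume.real (K ∩ {z | z.1 < 0 ∧ 0 < z.2}) := by
    have : combo (-1, 0) (0, 1) ⁻¹' K ∩ quadrant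
        = combo (-1, 0) (0, 1) ⁻¹' (K ∩ {z | z.1 < 0 ∧ 0 < z.2}) := by
      ext z
      simp only [Set.mem_inter_iff, Set.mem_preimage, quadrant, Set.mem_ofPred_eq, hr,
        Left.neg_neg_iff]
    have hc : cross (-1, 0) (0, 1) = -1 := by norm_num [cross]
    rw [this, volume_real_preimage_combo _ _ (by rw [hc]; norm_num), hc, abs_neg, abs_one,
      inv_one, one_mul]
  have hle : volume.real (K ∩ quadrant ∪ K ∩ {z | z.1 < 0 ∧ 0 < z.2})
      ≤ volume.real (K ∩ {z | 0 < z.2}) := by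
    refine measureReal_mono (Set.union_subset ?_ ?_) (hfin _)
    · exact Set.inter_subset_inter_right _ fun z hz => hz.2
    · exact Set.inter_subset_inter_right _ fun z hz => hz.2
  rw [measureReal_union hd (h.isClosed.measurableSet.inter hm) (hfin _) (hfin _)] at hle
  rwa [he]

theorem two_mul_add_le_volume (h : AuerbachPair K L) :
    2 * (volume.real (K ∩ quadrant) + volume.real (combo (-1, 0) (0, 1) ⁻¹' K ∩ quadrant))
      ≤ volume.real K := by
  linarith [h.two_mul_volume_upper_le, h.add_volume_le_upper]

theorem eight_le_volume_mul (h : AuerbachPair K L) : 8 ≤ volume.real K * volume.real L := by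
  have h1 := h.half_le_mul
  have h2 := h.reflect.half_le_mul
  have v1 := h.two_mul_add_le_volume
  have v2 := h.symm.two_mul_add_le_volume
  have q1 := h.half_le_volume
  have q2 := h.reflect.half_le_volume
  have q3 := h.symm.half_le_volume
  have q4 := h.reflect.symm.half_le_volume
  set a := volume.real (K ∩ quadrant)
  set b := volume.real (combo (-1, 0) (0, 1) ⁻¹' K ∩ quadrant)
  set c := volume.real (L ∩ quadrant)
  set d := volume.real (combo (-1, 0) (0, 1) ⁻¹' L ∩ quadrant)
  have h3 : 2 ≤ (a + b) * (c + d) := by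
    -- AM-GM: the product of `a * d` and `b * c` equals `(a * c) * (b * d) ≥ 1/4`.
    have : 1 ≤ a * d + b * c := by
      have hm : 1 / 4 ≤ (a * d) * (b * c) := by
        have := mul_le_mul h1 h2 (by norm_num) (by nlinarith)
        linarith
      nlinarith [sq_nonneg (a * d - b * c), mul_pos (show 0 < a by linarith)
        (show 0 < d by linarith), mul_pos (show 0 < b by linarith) (show 0 < c by linarith)]
    linarith
  have := mul_le_mul v1 v2 (by linarith) measureReal_nonneg
  linarith

theorem square_or_diamond (h : AuerbachPair K L) (he : volume.real K * volume.real L = 8) :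
    K = {x | |x.1| ≤ 1 ∧ |x.2| ≤ 1} ∨ K = {x | |x.1 + x.2| ≤ 1 ∧ |x.1 - x.2| ≤ 1} := by
  have hr : ∀ z : ℝ × ℝ, combo (-1, 0) (0, 1) z = (-z.1, z.2) := by
    intro z
    simp [combo_apply]
  have h1 := h.half_le_mul
  have h2 := h.reflect.half_le_mul
  have v1 := h.two_mul_add_le_volume
  have v2 := h.symm.two_mul_add_le_volume
  have q1 := h.half_le_volume
  have q2 := h.reflect.half_le_volume
  have q3 := h.symm.half_le_volume
  have q4 := h.reflect.symm.half_le_volume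
  have c1 := h.volume_eq_of_mul_eq_half
  have c2 := h.reflect.volume_eq_of_mul_eq_half
  have s1 := fun x => h.fst_add_snd_le (x := x)
  have s2 := fun x => h.reflect.fst_add_snd_le (x := x)
  set a := volume.real (K ∩ quadrant)
  set b := volume.real (combo (-1, 0) (0, 1) ⁻¹' K ∩ quadrant)
  set c := volume.real (L ∩ quadrant)
  set d := volume.real (combo (-1, 0) (0, 1) ⁻¹' L ∩ quadrant)
  have h3 : (a + b) * (c + d) ≤ 2 := by
    have := mul_le_mul v1 v2 (by linarith) measureReal_nonneg
    linarith
  have hm : 1 / 4 ≤ (a * c) * (b * d) := by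
    have := mul_le_mul h1 h2 (by norm_num) (by nlinarith)
    linarith
  have had : 0 < a * d := mul_pos (by linarith) (by linarith)
  have hbc : 0 < b * c := mul_pos (by linarith) (by linarith)
  have hsum : 1 ≤ a * d + b * c := by nlinarith [sq_nonneg (a * d - b * c)]
  have hac : a * c = 1 / 2 := by linarith
  have hbd : b * d = 1 / 2 := by linarith
  have hsum' : a * d + b * c = 1 := by linarith
  -- Equality in AM-GM gives `a * d = b * c`, while `a * c = b * d`; adding these, `a * (c + d) = b
  -- * (c + d)`. Here `a * d = b * d` suffices.
  have hab : a = b := by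
    have e1 : (a * d) * (b * c) = 1 / 4 := by
      linear_combination (b * d) * hac + 1 / 2 * hbd
    have e2 : (a * d - b * c) ^ 2 = 0 := by
      linear_combination (a * d + b * c + 1) * hsum' - 4 * e1
    have e3 : a * d = b * c := by
      have := pow_eq_zero_iff (two_ne_zero) |>.1 e2
      linarith
    have e4 : d * a = d * b := by linarith
    exact mul_left_cancel₀ (by linarith) e4
  have hx' : ∀ x ∈ K, ((-x.1, x.2) : ℝ × ℝ) ∈ combo (-1, 0) (0, 1) ⁻¹' K := by
    intro x hx
    rw [Set.mem_preimage, hr]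
    simpa using hx
  rcases c1 hac with ha | ⟨ha, hd⟩
  · right
    have hb : b = 1 / 2 := hab ▸ ha
    rw [ha] at s1
    rw [hb] at s2
    have up : ∀ x ∈ K, 0 ≤ x.2 → |x.1| + x.2 ≤ 1 := by
      intro x hx hx2
      rcases le_total 0 x.1 with h0 | h0
      · rw [abs_of_nonneg h0]
        linarith [s1 x hx h0 hx2]
      · rw [abs_of_nonpos h0]
        linarith [s2 _ (hx' x hx) (neg_nonneg.2 h0) hx2]
    have all : ∀ x ∈ K, |x.1| + |x.2| ≤ 1 := by
      intro x hx
      rcases le_total 0 x.2 with h0 | h0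
      · rw [abs_of_nonneg h0]
        exact up x hx h0
      · rw [abs_of_nonpos h0]
        simpa using up _ (h.neg_left x hx) (neg_nonneg.2 h0)
    ext x
    constructor
    · intro hx
      exact ⟨(abs_add_le _ _).trans (all x hx), (abs_sub _ _).trans (all x hx)⟩
    · rintro ⟨hx1, hx2⟩
      rw [h.mem_left]
      intro y hy
      have hy1 := h.symm.abs_fst_le hy
      have hy2 := h.symm.abs_snd_le hy
      have hx : |x.1| + |x.2| ≤ 1 := by
        rw [abs_le] at hx1 hx2
        rcases abs_cases x.1 with k1 | k1 <;> rcases abs_cases x.2 with k2 | k2 <;> linarith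
      have p1 := (le_abs_self (x.1 * y.1)).trans_eq (abs_mul _ _)
      have p2 := (le_abs_self (x.2 * y.2)).trans_eq (abs_mul _ _)
      have p3 := mul_le_of_le_one_right (abs_nonneg x.1) hy1
      have p4 := mul_le_of_le_one_right (abs_nonneg x.2) hy2
      simp only [dot]
      linarith
  · left
    have hb : b = 1 := hab ▸ ha
    have hd' : ((-1, 1) : ℝ × ℝ) ∈ K := by
      rcases c2 hbd with k | ⟨_, k⟩
      · linarith
      · rwa [Set.mem_preimage, hr] at k
    ext x
    constructor
    · intro hx
      exact ⟨h.abs_fst_le hx, h.abs_snd_le hx⟩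
    · rintro ⟨hx1, hx2⟩
      rw [h.mem_left]
      intro y hy
      have k1 := (h.mem_left _).1 hd y hy
      have k2 := (h.mem_left _).1 hd' y hy
      have k3 := (h.mem_left _).1 (h.neg_left _ hd) y hy
      have k4 := (h.mem_left _).1 (h.neg_left _ hd') y hy
      simp only [dot, Prod.fst_neg, Prod.snd_neg] at k1 k2 k3 k4
      have hy : |y.1| + |y.2| ≤ 1 := by
        rcases abs_cases y.1 with l1 | l1 <;> rcases abs_cases y.2 with l2 | l2 <;> linarith
      have p1 := (le_abs_self (x.1 * y.1)).trans_eq (abs_mul _ _)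
      have p2 := (le_abs_self (x.2 * y.2)).trans_eq (abs_mul _ _)
      have p3 := mul_le_of_le_one_left (abs_nonneg y.1) hx1
      have p4 := mul_le_of_le_one_left (abs_nonneg y.2) hx2
      simp only [dot]
      linarith

end AuerbachPair

/-! ### Linear invariance and reduction to Auerbach position -/

theorem dot_combo (e f x y : ℝ × ℝ) :
    dot (combo e f x) y = dot x (combo (e.1, f.1) (e.2, f.2) y) := by
  simp only [dot, combo_apply]
  ring

theorem cross_transpose (e f : ℝ × ℝ) : cross (e.1, f.1) (e.2, f.2) = cross e f := by
  simp only [cross]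
  ring

theorem combo_surjective {e f : ℝ × ℝ} (h : cross e f ≠ 0) :
    Function.Surjective (combo e f) := by
  intro z
  refine ⟨(cross z f / cross e f, cross e z / cross e f), ?_⟩
  rw [combo_apply]
  ext
  · field_simp; simp only [cross]; ring
  · field_simp; simp only [cross]; ring

/-- The polar of a set in the coordinate plane. -/
def planePolar (K : Set (ℝ × ℝ)) : Set (ℝ × ℝ) := {y | ∀ x ∈ K, dot x y ≤ 1}

theorem mem_planePolar {K : Set (ℝ × ℝ)} {y : ℝ × ℝ} :
    y ∈ planePolar K ↔ ∀ x ∈ K, dot x y ≤ 1 := Iff.rfl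

theorem planePolar_image_combo (e f : ℝ × ℝ) (S : Set (ℝ × ℝ)) :
    planePolar (combo e f '' S) = combo (e.1, f.1) (e.2, f.2) ⁻¹' planePolar S := by
  ext y
  simp only [mem_planePolar, Set.mem_preimage, Set.forall_mem_image, dot_combo]

/-- The volume product is invariant under linear automorphisms. -/
theorem volume_product_image_combo {e f : ℝ × ℝ} (h : cross e f ≠ 0) (S : Set (ℝ × ℝ)) :
    volume.real (combo e f '' S) * volume.real (planePolar (combo e f '' S))
      = volume.real S * volume.real (planePolar S) := by
  rw [planePolar_image_combo, volume_real_image_combo,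
    volume_real_preimage_combo _ _ (by rwa [cross_transpose]), cross_transpose]
  have := abs_ne_zero.2 h
  field_simp

/-- The bipolar theorem: a separating functional, scaled by its level `u > 0`, is a point of the
polar that excludes `x`. -/
theorem mem_of_forall_mem_planePolar {K : Set (ℝ × ℝ)} (hK : Convex ℝ K) (hc : IsClosed K)
    (h0 : (0 : ℝ × ℝ) ∈ K) {x : ℝ × ℝ} (hx : ∀ y ∈ planePolar K, dot x y ≤ 1) : x ∈ K := by
  by_contra hxK
  obtain ⟨g, u, hg, hu⟩ := geometric_hahn_banach_closed_point hK hc hxK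
  have hu0 : 0 < u := by simpa using hg 0 h0
  have hd : ∀ z : ℝ × ℝ, dot z (g (1, 0) / u, g (0, 1) / u) = g z / u := by
    intro z
    have : z = z.1 • ((1, 0) : ℝ × ℝ) + z.2 • ((0, 1) : ℝ × ℝ) := by ext <;> simp
    conv_rhs => rw [this, map_add, map_smul, map_smul]
    simp only [dot, smul_eq_mul]
    ring
  have h1 := hx (g (1, 0) / u, g (0, 1) / u) (by
    intro z hz
    rw [hd, div_le_one hu0]
    exact (hg z hz).le)
  rw [hd, div_le_one hu0] at h1
  linarith

theorem exists_cross_pos {K : Set (ℝ × ℝ)} (hint : (interior K).Nonempty) :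
    ∃ x ∈ K, ∃ y ∈ K, 0 < cross x y := by
  obtain ⟨z, hz⟩ := hint
  rw [mem_interior_iff_mem_nhds, Metric.mem_nhds_iff] at hz
  obtain ⟨ε, hε, hb⟩ := hz
  have h0 : z ∈ K := hb (Metric.mem_ball_self hε)
  have h1 : z + (ε / 2, 0) ∈ K := hb (by
    rw [Metric.mem_ball, dist_self_add_left, Prod.norm_def]
    simp [abs_of_pos hε, hε])
  have h2 : z + (0, ε / 2) ∈ K := hb (by
    rw [Metric.mem_ball, dist_self_add_left, Prod.norm_def]
    simp [abs_of_pos hε, hε])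
  -- If no determinant were positive, testing `z` against each translate in both orders would give
  -- `z = 0`; the two translates then have determinant `ε² / 4 > 0`.
  by_contra! hn
  have a1 := hn _ h0 _ h1
  have a2 := hn _ h1 _ h0
  have a3 := hn _ h0 _ h2
  have a4 := hn _ h2 _ h0
  have a5 := hn _ h1 _ h2
  simp only [cross, Prod.fst_add, Prod.snd_add] at a1 a2 a3 a4 a5
  nlinarith [mul_pos hε hε]

/-- Maximality of `cross e f` is tested by replacing `e` or `f` with another point of `K`: by
Cramer's rule its coordinates are at most 1, so the basis vectors lie in the polar. -/
theorem exists_auerbachPair {K : Set (ℝ × ℝ)} (hK : Convex ℝ K) (hc : IsCompact K)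
    (hneg : ∀ x ∈ K, -x ∈ K) (hint : (interior K).Nonempty) :
    ∃ e f : ℝ × ℝ, cross e f ≠ 0 ∧
      AuerbachPair (combo e f ⁻¹' K) (planePolar (combo e f ⁻¹' K)) := by
  obtain ⟨x, hx, y, hy, hxy⟩ := exists_cross_pos hint
  have hcont : Continuous fun p : (ℝ × ℝ) × (ℝ × ℝ) => cross p.1 p.2 := by
    unfold cross
    fun_prop
  obtain ⟨⟨e, f⟩, ⟨he, hf⟩, hmax⟩ := (hc.prod hc).exists_isMaxOn ⟨(x, y), hx, hy⟩ hcont.continuousOn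
  have hmax' : ∀ a ∈ K, ∀ b ∈ K, cross a b ≤ cross e f := fun a ha b hb =>
    hmax (show (a, b) ∈ K ×ˢ K from ⟨ha, hb⟩)
  have hD : 0 < cross e f := hxy.trans_le (hmax' x hx y hy)
  have hbox : ∀ z ∈ combo e f ⁻¹' K, z.1 ≤ 1 ∧ z.2 ≤ 1 := by
    intro z hz
    rw [Set.mem_preimage] at hz
    have h1 := hmax' _ hz f hf
    have h2 := hmax' e he _ hz
    have e1 : cross (combo e f z) f = z.1 * cross e f := by
      simp only [cross, combo_apply]; ring
    have e2 : cross e (combo e f z) = z.2 * cross e f := by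
      simp only [cross, combo_apply]; ring
    rw [e1] at h1
    rw [e2] at h2
    exact ⟨by nlinarith, by nlinarith⟩
  have h0 : (0 : ℝ × ℝ) ∈ K := by
    have := hK hx (hneg x hx) (a := 1 / 2) (b := 1 / 2) (by norm_num) (by norm_num) (by norm_num)
    simpa using this
  refine ⟨e, f, hD.ne', ⟨fun z => ⟨fun hz w hw => hw z hz, fun hz => ?_⟩, fun _ => Iff.rfl, ?_, ?_,
    ?_, ?_, ?_⟩⟩
  · refine mem_of_forall_mem_planePolar (hK.linear_preimage _)
      (hc.isClosed.preimage (LinearMap.continuous_of_finiteDimensional _)) ?_ hz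
    rwa [Set.mem_preimage, map_zero]
  · intro z hz
    rw [Set.mem_preimage, map_neg]
    exact hneg _ hz
  · rw [Set.mem_preimage, combo_apply]
    simpa using he
  · rw [Set.mem_preimage, combo_apply]
    simpa using hf
  · intro z hz
    simpa [dot] using (hbox z hz).1
  · intro z hz
    simpa [dot] using (hbox z hz).2

/-! ### The square, the diamond and the theorem in coordinates -/

/-- The square `[-1, 1]²`. -/
def unitSquare : Set (ℝ × ℝ) := {x | |x.1| ≤ 1 ∧ |x.2| ≤ 1}

theorem volume_real_unitSquare : volume.real unitSquare = 4 := by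
  have : unitSquare = Set.Icc (-1 : ℝ) 1 ×ˢ Set.Icc (-1 : ℝ) 1 := by
    ext x
    simp only [unitSquare, Set.mem_ofPred_eq, Set.mem_prod, Set.mem_Icc, abs_le]
  rw [this, measureReal_def, Measure.volume_eq_prod, Measure.prod_prod, Real.volume_Icc,
    ENNReal.toReal_mul, ENNReal.toReal_ofReal (by norm_num)]
  norm_num

theorem diamond_eq_image_combo : {x : ℝ × ℝ | |x.1 + x.2| ≤ 1 ∧ |x.1 - x.2| ≤ 1}
    = combo (1 / 2, 1 / 2) (1 / 2, -1 / 2) '' unitSquare := by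
  ext x
  constructor
  · intro hx
    refine ⟨(x.1 + x.2, x.1 - x.2), hx, ?_⟩
    rw [combo_apply]
    ext <;> simp <;> ring
  · rintro ⟨z, hz, rfl⟩
    rw [combo_apply, Set.mem_ofPred_eq]
    obtain ⟨h1, h2⟩ := hz
    refine ⟨?_, ?_⟩
    · convert h1 using 2; ring
    · convert h2 using 2; ring

theorem planePolar_unitSquare :
    planePolar unitSquare = {x | |x.1 + x.2| ≤ 1 ∧ |x.1 - x.2| ≤ 1} := by
  ext y
  rw [mem_planePolar, Set.mem_ofPred_eq]
  constructor
  · intro h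
    have h1 := h (1, 1) (by simp [unitSquare])
    have h2 := h (1, -1) (by simp [unitSquare])
    have h3 := h (-1, 1) (by simp [unitSquare])
    have h4 := h (-1, -1) (by simp [unitSquare])
    simp only [dot] at h1 h2 h3 h4
    rw [abs_le, abs_le]
    refine ⟨⟨?_, ?_⟩, ?_, ?_⟩ <;> linarith
  · rintro ⟨h1, h2⟩ x ⟨hx1, hx2⟩
    have hy : |y.1| + |y.2| ≤ 1 := by
      rw [abs_le] at h1 h2
      rcases abs_cases y.1 with k1 | k1 <;> rcases abs_cases y.2 with k2 | k2 <;> linarith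
    have p1 := (le_abs_self (x.1 * y.1)).trans_eq (abs_mul _ _)
    have p2 := (le_abs_self (x.2 * y.2)).trans_eq (abs_mul _ _)
    have p3 := mul_le_of_le_one_left (abs_nonneg y.1) hx1
    have p4 := mul_le_of_le_one_left (abs_nonneg y.2) hx2
    simp only [dot]
    linarith

theorem volume_product_unitSquare :
    volume.real unitSquare * volume.real (planePolar unitSquare) = 8 := by
  rw [planePolar_unitSquare, diamond_eq_image_combo, volume_real_image_combo,
    volume_real_unitSquare]
  norm_num [cross]

theorem eight_le_volume_product {K : Set (ℝ × ℝ)} (hK : Convex ℝ K) (hc : IsCompact K)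
    (hneg : ∀ x ∈ K, -x ∈ K) (hint : (interior K).Nonempty) :
    8 ≤ volume.real K * volume.real (planePolar K) := by
  obtain ⟨e, f, hD, h⟩ := exists_auerbachPair hK hc hneg hint
  rw [← Set.image_preimage_eq K (combo_surjective hD), volume_product_image_combo hD]
  exact h.eight_le_volume_mul

theorem exists_eq_image_unitSquare {K : Set (ℝ × ℝ)} (hK : Convex ℝ K) (hc : IsCompact K)
    (hneg : ∀ x ∈ K, -x ∈ K) (hint : (interior K).Nonempty)
    (h8 : volume.real K * volume.real (planePolar K) = 8) :
    ∃ e f : ℝ × ℝ, cross e f ≠ 0 ∧ K = combo e f '' unitSquare := by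
  obtain ⟨e, f, hD, h⟩ := exists_auerbachPair hK hc hneg hint
  have hKim := Set.image_preimage_eq K (combo_surjective hD)
  rw [← hKim, volume_product_image_combo hD] at h8
  rcases h.square_or_diamond h8 with hs | hs
  · exact ⟨e, f, hD, by rw [← hKim, hs]; rfl⟩
  -- The diamond is itself a linear image of the square; its half-axes are carried along by `combo e
  -- f`.
  · refine ⟨combo e f (1 / 2, 1 / 2), combo e f (1 / 2, -1 / 2), ?_, ?_⟩
    · have : cross (combo e f (1 / 2, 1 / 2)) (combo e f (1 / 2, -1 / 2))
          = -1 / 2 * cross e f := by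
        simp only [cross, combo_apply]; ring
      rw [this]
      exact mul_ne_zero (by norm_num) hD
    · rw [← hKim, hs, diamond_eq_image_combo, Set.image_image]
      refine Set.image_congr fun z _ => ?_
      simp only [combo_apply]
      ext <;> simp <;> ring

/-! ### Transfer to the Euclidean plane -/

/-- The coordinates of a point of the Euclidean plane. -/
noncomputable def planeCoords : EuclideanSpace ℝ (Fin 2) ≃L[ℝ] ℝ × ℝ :=
  (EuclideanSpace.equiv (Fin 2) ℝ).trans (ContinuousLinearEquiv.finTwoArrow ℝ ℝ)

theorem planeCoords_apply (x : EuclideanSpace ℝ (Fin 2)) : planeCoords x = (x 0, x 1) := rfl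

theorem measurePreserving_planeCoords : MeasurePreserving planeCoords :=
  (volume_preserving_finTwoArrow ℝ).comp (PiLp.volume_preserving_ofLp (Fin 2))

theorem volume_real_image_planeCoords (S : Set (EuclideanSpace ℝ (Fin 2))) :
    volume.real (planeCoords '' S) = volume.real S := by
  rw [← planeCoords.injective.preimage_image S, measureReal_def, measureReal_def,
    measurePreserving_planeCoords.measure_preimage_emb
      planeCoords.toHomeomorph.measurableEmbedding, planeCoords.injective.preimage_image S]

theorem inner_eq_dot (x y : EuclideanSpace ℝ (Fin 2)) :
    inner ℝ x y = dot (planeCoords y) (planeCoords x) := by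
  simp [PiLp.inner_apply, Fin.sum_univ_two, dot, planeCoords_apply]

theorem image_polarBody (K : Set (EuclideanSpace ℝ (Fin 2))) :
    planeCoords '' polarBody K = planePolar (planeCoords '' K) := by
  ext y
  obtain ⟨y, rfl⟩ := planeCoords.surjective y
  rw [planeCoords.injective.mem_set_image, mem_planePolar, Set.forall_mem_image]
  simp only [polarBody, Set.mem_ofPred_eq, inner_eq_dot]

theorem linearIndependent_pair_iff_cross (u v : EuclideanSpace ℝ (Fin 2)) :
    LinearIndependent ℝ ![u, v] ↔ cross (planeCoords u) (planeCoords v) ≠ 0 := by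
  rw [LinearIndependent.pair_iff]
  simp only [cross, planeCoords_apply]
  constructor
  · intro h h0
    have h1 := h (v 1) (-u 1) (by
      ext i; fin_cases i
      · simp; linarith
      · simp; ring)
    have h2 := h (v 0) (-u 0) (by
      ext i; fin_cases i
      · simp; ring
      · simp; linarith)
    have hu0 : u 0 = 0 := by linarith [h2.2]
    have hu1 : u 1 = 0 := by linarith [h1.2]
    have h3 := h 1 0 (by ext i; fin_cases i <;> simp [hu0, hu1])
    exact one_ne_zero h3.1
  · intro h s t hst
    have h0 := congrArg (fun w : EuclideanSpace ℝ (Fin 2) => w 0) hst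
    have h1 := congrArg (fun w : EuclideanSpace ℝ (Fin 2) => w 1) hst
    simp at h0 h1
    constructor
    · refine (mul_eq_zero.1 ?_).resolve_right h
      linear_combination v 1 * h0 - v 0 * h1
    · refine (mul_eq_zero.1 ?_).resolve_right h
      linear_combination u 0 * h1 - u 1 * h0

theorem mem_parallelepiped_pair (u v x : EuclideanSpace ℝ (Fin 2)) :
    x ∈ parallelepiped ![u, v] ↔
      ∃ s t : ℝ, (0 ≤ s ∧ s ≤ 1) ∧ (0 ≤ t ∧ t ≤ 1) ∧ x = s • u + t • v := by
  rw [mem_parallelepiped_iff]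
  constructor
  · rintro ⟨w, hw, rfl⟩
    exact ⟨w 0, w 1, ⟨hw.1 0, hw.2 0⟩, ⟨hw.1 1, hw.2 1⟩, by simp [Fin.sum_univ_two]⟩
  · rintro ⟨s, t, hs, ht, rfl⟩
    refine ⟨![s, t], ⟨?_, ?_⟩, by simp [Fin.sum_univ_two]⟩
    · intro i; fin_cases i
      · exact hs.1
      · exact ht.1
    · intro i; fin_cases i
      · exact hs.2
      · exact ht.2

/-- The symmetric parallelogram with half-axes `a` and `b` as a set of points of the Euclidean
plane. -/
theorem mem_image_unitSquare_iff (a b x : EuclideanSpace ℝ (Fin 2)) :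
    planeCoords x ∈ combo (planeCoords a) (planeCoords b) '' unitSquare ↔
      ∃ s t : ℝ, |s| ≤ 1 ∧ |t| ≤ 1 ∧ x = s • a + t • b := by
  have hc : ∀ z : ℝ × ℝ,
      combo (planeCoords a) (planeCoords b) z = planeCoords (z.1 • a + z.2 • b) := by
    intro z
    rw [combo_apply, map_add, map_smul, map_smul]
    ext <;> simp <;> ring
  constructor
  · rintro ⟨z, hz, h⟩
    rw [hc] at h
    exact ⟨z.1, z.2, hz.1, hz.2, (planeCoords.injective h).symm⟩
  · rintro ⟨s, t, hs, ht, rfl⟩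
    exact ⟨(s, t), ⟨hs, ht⟩, hc _⟩

theorem isParallelogram_iff {K : Set (EuclideanSpace ℝ (Fin 2))} (hneg : ∀ x ∈ K, -x ∈ K) :
    IsParallelogram K ↔
      ∃ e f : ℝ × ℝ, cross e f ≠ 0 ∧ planeCoords '' K = combo e f '' unitSquare := by
  constructor
  · rintro ⟨p, u, v, hli, rfl⟩
    -- Symmetry centres the parallelogram at the origin. Writing `-p` and `-(p + u + v)` as points
    -- of it with coefficients `s, t` and `s', t'` gives `s = 1 + s'` and `t = 1 + t'`, so `s = t =
    -- 1`.
    have hp : (2 : ℝ) • p = -u - v := by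
      obtain ⟨_, h1, h1'⟩ := hneg _ ⟨0, (mem_parallelepiped_pair u v 0).2
        ⟨0, 0, by norm_num, by norm_num, by simp⟩, rfl⟩
      obtain ⟨_, h2, h2'⟩ := hneg _ ⟨u + v, (mem_parallelepiped_pair u v _).2
        ⟨1, 1, by norm_num, by norm_num, by simp⟩, rfl⟩
      obtain ⟨s, t, hs, ht, rfl⟩ := (mem_parallelepiped_pair u v _).1 h1
      obtain ⟨s', t', hs', ht', rfl⟩ := (mem_parallelepiped_pair u v _).1 h2
      simp only [add_zero] at h1' h2'
      have e1 : (2 : ℝ) • p = -(s • u + t • v) := by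
        rw [← sub_eq_zero, ← sub_eq_zero.2 h1']; module
      have e2 : (1 + s' - s) • u + (1 + t' - t) • v = 0 := by
        rw [← sub_self (0 : EuclideanSpace ℝ (Fin 2))]
        nth_rw 1 [← sub_eq_zero.2 h2']
        rw [← sub_eq_zero.2 h1']
        module
      have e3 := LinearIndependent.pair_iff.1 hli _ _ e2
      have hs1 : s = 1 := by linarith [e3.1]
      have ht1 : t = 1 := by linarith [e3.2]
      rw [e1, hs1, ht1, one_smul, one_smul]
      abel
    have hp' : p = -((1 / 2 : ℝ) • u) - (1 / 2 : ℝ) • v := by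
      have := congrArg (fun w => (1 / 2 : ℝ) • w) hp
      simp only [smul_smul, smul_sub, smul_neg] at this
      norm_num at this
      rw [this]
    refine ⟨planeCoords ((1 / 2 : ℝ) • u), planeCoords ((1 / 2 : ℝ) • v), ?_, ?_⟩
    · rw [linearIndependent_pair_iff_cross] at hli
      intro h0
      apply hli
      simp only [cross, map_smul, Prod.smul_fst, Prod.smul_snd, smul_eq_mul] at h0 ⊢
      linarith
    · ext x
      obtain ⟨x, rfl⟩ := planeCoords.surjective x
      rw [planeCoords.injective.mem_set_image, mem_image_unitSquare_iff]
      constructor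
      · rintro ⟨_, hy, rfl⟩
        obtain ⟨s, t, hs, ht, rfl⟩ := (mem_parallelepiped_pair u v _).1 hy
        refine ⟨2 * s - 1, 2 * t - 1, abs_le.2 ⟨by linarith, by linarith⟩,
          abs_le.2 ⟨by linarith, by linarith⟩, ?_⟩
        simp only [hp']
        module
      · rintro ⟨s, t, hs, ht, rfl⟩
        rw [abs_le] at hs ht
        refine ⟨_, (mem_parallelepiped_pair u v _).2 ⟨(s + 1) / 2, (t + 1) / 2,
          ⟨by linarith, by linarith⟩, ⟨by linarith, by linarith⟩, rfl⟩, ?_⟩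
        simp only [hp']
        module
  · rintro ⟨e, f, hD, h⟩
    obtain ⟨a, rfl⟩ := planeCoords.surjective e
    obtain ⟨b, rfl⟩ := planeCoords.surjective f
    refine ⟨-a - b, (2 : ℝ) • a, (2 : ℝ) • b, ?_, ?_⟩
    · rw [linearIndependent_pair_iff_cross]
      intro h0
      apply hD
      simp only [cross, map_smul, Prod.smul_fst, Prod.smul_snd, smul_eq_mul] at h0 ⊢
      linarith
    · ext x
      rw [← planeCoords.injective.mem_set_image (s := K), h, mem_image_unitSquare_iff]
      constructor
      · rintro ⟨s, t, hs, ht, rfl⟩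
        rw [abs_le] at hs ht
        refine ⟨_, (mem_parallelepiped_pair _ _ _).2 ⟨(s + 1) / 2, (t + 1) / 2,
          ⟨by linarith, by linarith⟩, ⟨by linarith, by linarith⟩, rfl⟩, ?_⟩
        module
      · rintro ⟨_, hy, rfl⟩
        obtain ⟨s, t, hs, ht, rfl⟩ := (mem_parallelepiped_pair _ _ _).1 hy
        refine ⟨2 * s - 1, 2 * t - 1, abs_le.2 ⟨by linarith, by linarith⟩,
          abs_le.2 ⟨by linarith, by linarith⟩, ?_⟩
        module

/-- Mathlib's `ConvexBody` is a nonempty compact convex set; the non-empty interior is the separate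
hypothesis `hint`. -/
theorem mainTheorem10 (K : ConvexBody (EuclideanSpace ℝ (Fin 2)))
    (hint : (interior (K : Set (EuclideanSpace ℝ (Fin 2)))).Nonempty)
    (hsymm : ∀ x ∈ K, -x ∈ K) :
    8 ≤ volume.real (K : Set (EuclideanSpace ℝ (Fin 2))) *
        volume.real (polarBody (K : Set (EuclideanSpace ℝ (Fin 2)))) ∧
      (volume.real (K : Set (EuclideanSpace ℝ (Fin 2))) *
          volume.real (polarBody (K : Set (EuclideanSpace ℝ (Fin 2)))) = 8 ↔
        IsParallelogram (K : Set (EuclideanSpace ℝ (Fin 2)))) := by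
  have hconv : Convex ℝ (planeCoords '' (K : Set (EuclideanSpace ℝ (Fin 2)))) :=
    K.convex.linear_image planeCoords.toLinearEquiv.toLinearMap
  have hcomp : IsCompact (planeCoords '' (K : Set (EuclideanSpace ℝ (Fin 2)))) :=
    K.isCompact.image planeCoords.continuous
  have hneg : ∀ x ∈ planeCoords '' (K : Set (EuclideanSpace ℝ (Fin 2))),
      -x ∈ planeCoords '' (K : Set (EuclideanSpace ℝ (Fin 2))) := by
    rintro _ ⟨x, hx, rfl⟩
    exact ⟨-x, hsymm x hx, map_neg _ _⟩
  have hint' : (interior (planeCoords '' (K : Set (EuclideanSpace ℝ (Fin 2))))).Nonempty := by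
    have := planeCoords.toHomeomorph.image_interior (K : Set (EuclideanSpace ℝ (Fin 2)))
    rw [ContinuousLinearEquiv.coe_toHomeomorph] at this
    rw [← this]
    exact hint.image _
  rw [← volume_real_image_planeCoords (polarBody _), image_polarBody,
    ← volume_real_image_planeCoords (K : Set (EuclideanSpace ℝ (Fin 2)))]
  refine ⟨eight_le_volume_product hconv hcomp hneg hint', ?_⟩
  rw [isParallelogram_iff hsymm]
  refine ⟨exists_eq_image_unitSquare hconv hcomp hneg hint', ?_⟩
  rintro ⟨e, f, hD, h⟩
  rw [h, volume_product_image_combo hD, volume_product_unitSquare]
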